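/- Let $n\ge 2$, $\alpha>0$ and $r>0$. Let $\Gamma\subset\mathbb R^n$ be an open cone, invariant under permutations of the coordinates, with $\Gamma_+=\{\lambda\in\mathbb R^n:\lambda_i>0\ \forall i\}\subset\Gamma$, and let $\gamma:\Gamma\to(0,\infty)$ be a function such that a) $\gamma$ is smooth and symmetric: $\gamma(\lambda_{\sigma(1)},\dots,\lambda_{\sigma(n)})=\gamma(\lambda_1,\dots,\lambda_n)$ for every permutation $\sigma$; b) $\gamma$ is $\alpha$-homogeneous: $\gamma(c\lambda)=c^\alpha\gamma(\lambda)$ for all $\lambda\in\Gamma$ and $c>0$; c) $\frac{\partial\gamma}{\partial\lambda_i}(\lambda)>0$ for all $\lambda\in\Gamma$ and $i=1,\dots,n$; d) there is a continuous function $\tilde\gamma:\overline\Gamma\to[0,\infty)$ with $\tilde\gamma|_\Gamma=\gamma$ and $\tilde\gamma|_{\partial\Gamma}=0$. Let $B_r^n(0)\subset\mathbb R^n$ be the open ball, $u:B_r^n(0)\to\mathbb R$ a smooth function and $\Sigma=\{(x,u(x)):x\in B_r^n(0)\}\subset\mathbb R^{n+1}$ its graph, with unit normal $\nu=(-Du,1)/\sqrt{1+|Du|^2}$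 and principal curvatures $\lambda_1(p)\le\dots\le\lambda_n(p)$ at $p\in\Sigma$, i.e. the eigenvalues of the Weingarten map $h^i_j=g^{ik}h_{kj}$, where $g_{ij}=\langle\partial_iX,\partial_jX\rangle$, $h_{ij}=\langle\partial_i\partial_jX,\nu\rangle$ and $X(x)=(x,u(x))$. Write $\lambda=(\lambda_1,\dots,\lambda_n)$. Suppose that 1. $\Sigma$ is complete for its intrinsic distance; 2. $\Sigma$ is a $\gamma$-translator: $\lambda(p)\in\Gamma$ and $\gamma(\lambda(p))=\langle\nu(p),e_{n+1}\rangle$ for every $p\in\Sigma$; 3. $\Sigma$ is strictly convex: $\lambda(p)\in\Gamma_+$ for every $p\in\Sigma$; 4. $\Sigma$ has a single end, and this end is $\mathcal C^2$-asymptotic to the cylinder $\mathbb S^{n-1}(r)\times\mathbb R$, in the sense that $\lambda_1(p)\to0$ and $\lambda_i(p)\to\frac1r$ for every $i\in\{2,\dots,n\}$, as $|p|\to\infty$ in $\Sigma$. Then $\Sigma$ is rotationally symmetric with respect to the $x_{n+1}$-axis: $A(\Sigma)=\Sigma$ for every linear isometry $A$ of $\mathbb R^{n+1}$ with $A e_{n+1}=e_{n+1}$.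 -/

import Mathlib

open Set Filter Topology Metric
open scoped ContDiff ENNReal

noncomputable section

/-- Euclidean space `ℝ^m`. -/
abbrev Euc (m : ℕ) : Type := EuclideanSpace ℝ (Fin m)

/-! ### The curvature function -/

/-- The structural conditions on the speed function `γ : Γ → (0, ∞)`: `Γ ⊆ ℝ^n` is a symmetric
open cone containing the positive cone; `γ` is positive, smooth and symmetric, homogeneous of
degree `α > 0`, strictly increasing in each argument (positive partial derivatives), and it extends
continuously to the closure of `Γ` with value `0` on the boundary of `Γ`. (The values of `γ`
outside `Γ` are irrelevant.) -/
structure IsSpeedFunction {n : ℕ} (Γ : Set (Fin n → ℝ)) (γ : (Fin n → ℝ) → ℝ) (α : ℝ) : Prop where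
  isOpen : IsOpen Γ
  cone : ∀ l ∈ Γ, ∀ c : ℝ, 0 < c → c • l ∈ Γ
  symm_domain : ∀ l ∈ Γ, ∀ σ : Equiv.Perm (Fin n), l ∘ σ ∈ Γ
  pos_cone_subset : {l : Fin n → ℝ | ∀ i, 0 < l i} ⊆ Γ
  pos : ∀ l ∈ Γ, 0 < γ l
  smooth : ContDiffOn ℝ ∞ γ Γ
  symm : ∀ l ∈ Γ, ∀ σ : Equiv.Perm (Fin n), γ (l ∘ σ) = γ l
  degree_pos : 0 < α
  homogeneous : ∀ l ∈ Γ, ∀ c : ℝ, 0 < c → γ (c • l) = c ^ α * γ l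
  increasing : ∀ l ∈ Γ, ∀ i : Fin n, 0 < fderiv ℝ γ l (Pi.single i 1)
  boundary : ∃ γ' : (Fin n → ℝ) → ℝ, ContinuousOn γ' (closure Γ) ∧ (∀ l ∈ closure Γ, 0 ≤ γ' l) ∧
    EqOn γ' γ Γ ∧ ∀ l ∈ frontier Γ, γ' l = 0

/-! ### Geometry of parametrized hypersurfaces -/

/-- The coordinate tangent vector `∂_i X` of a parametrization `X`. -/
def tangentVec {n : ℕ} (X : Euc n → Euc (n + 1)) (x : Euc n) (i : Fin n) : Euc (n + 1) :=
  fderiv ℝ X x (EuclideanSpace.single i 1)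

/-- The coordinate second derivative `∂_i ∂_j X`. -/
def secondDeriv {n : ℕ} (X : Euc n → Euc (n + 1)) (x : Euc n) (i j : Fin n) : Euc (n + 1) :=
  fderiv ℝ (fun y => tangentVec X y j) x (EuclideanSpace.single i 1)

/-- The induced metric `g_ij = ⟨∂_i X, ∂_j X⟩`. -/
def metricMatrix {n : ℕ} (X : Euc n → Euc (n + 1)) (x : Euc n) : Matrix (Fin n) (Fin n) ℝ :=
  Matrix.of fun i j => inner ℝ (tangentVec X x i) (tangentVec X x j)

/-- The second fundamental form `h_ij = ⟨∂_i ∂_j X, ν⟩` with respect to the unit normal `ν`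
(positive definite when the hypersurface bends strictly towards `ν`). -/
def secondFundForm {n : ℕ} (X ν : Euc n → Euc (n + 1)) (x : Euc n) : Matrix (Fin n) (Fin n) ℝ :=
  Matrix.of fun i j => inner ℝ (secondDeriv X x i j) (ν x)

/-- The matrix `h^i_j = g^{ik} h_kj` of the Weingarten map. -/
def weingarten {n : ℕ} (X ν : Euc n → Euc (n + 1)) (x : Euc n) : Matrix (Fin n) (Fin n) ℝ :=
  (metricMatrix X x)⁻¹ * secondFundForm X ν x

/-- The principal curvatures `λ_1 ≤ ... ≤ λ_n`: the eigenvalues of the Weingarten map, listed with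
multiplicity in increasing order. (The Weingarten map of an immersion is diagonalizable over `ℝ`,
so that there are exactly `n` of them and the default value `0` is never used.) -/
def principalCurvatures {n : ℕ} (X ν : Euc n → Euc (n + 1)) (x : Euc n) : Fin n → ℝ :=
  fun i => ((weingarten X ν x).charpoly.roots.sort (· ≤ ·)).getD i 0

/-! ### Graphs -/

/-- The direction `e_{n+1}` of translation. -/
def eLast (n : ℕ) : Euc (n + 1) := EuclideanSpace.single (Fin.last n) 1

/-- The graph parametrization `x ↦ (x, u x)`. -/
def graphMap {n : ℕ} (u : Euc n → ℝ) (x : Euc n) : Euc (n + 1) :=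
  WithLp.toLp 2 (Fin.snoc (α := fun _ => ℝ) (fun i => x i) (u x))

/-- The projection `(x, x_{n+1}) ↦ x`. -/
def baseProj {n : ℕ} (p : Euc (n + 1)) : Euc n :=
  WithLp.toLp 2 fun i : Fin n => p i.castSucc

/-- The upward unit normal `(-Du, 1) / √(1 + |Du|²)` of the graph of `u`. It is the inward normal
of a graph which is convex with respect to it. -/
def graphNormal {n : ℕ} (u : Euc n → ℝ) (x : Euc n) : Euc (n + 1) :=
  (Real.sqrt (1 + ‖gradient u x‖ ^ 2))⁻¹ •
    WithLp.toLp 2 (Fin.snoc (α := fun _ => ℝ) (fun i => -gradient u x i) 1)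

/-- The principal curvatures of the graph of `u` at its point `p`, with respect to the upward unit
normal. -/
def graphCurvatures {n : ℕ} (u : Euc n → ℝ) (p : Euc (n + 1)) : Fin n → ℝ :=
  principalCurvatures (graphMap u) (graphNormal u) (baseProj p)

/-! ### Completeness, ends, asymptotics, symmetry -/

/-- The intrinsic distance of two points of `S`: the infimum of the lengths of the curves in `S`
that join them (`∞` if there is none). -/
def intrinsicEDist {m : ℕ} (S : Set (Euc m)) (p q : Euc m) : ℝ≥0∞ :=
  ⨅ (c : ℝ → Euc m) (_ : ContinuousOn c (Icc 0 1) ∧ MapsTo c (Icc 0 1) S ∧ c 0 = p ∧ c 1 = q),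
    eVariationOn c (Icc 0 1)

/-- Metric completeness of `S` for its intrinsic distance: intrinsic Cauchy sequences converge
in `S`. -/
def IsIntrinsicallyComplete {m : ℕ} (S : Set (Euc m)) : Prop :=
  ∀ p : ℕ → Euc m, (∀ k, p k ∈ S) →
    (∀ ε : ℝ≥0∞, 0 < ε → ∃ N, ∀ j ≥ N, ∀ k ≥ N, intrinsicEDist S (p j) (p k) < ε) →
    ∃ q ∈ S, Tendsto (fun k => intrinsicEDist S (p k) q) atTop (𝓝 0)

/-- `S` has a single end: for every compact `K ⊆ S`, exactly one connected component of `S \ K`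
is not relatively compact in `S`. -/
def HasSingleEnd {m : ℕ} (S : Set (Euc m)) : Prop :=
  ∀ K : Set (Euc m), IsCompact K → K ⊆ S →
    ∃! C : Set (Euc m), (∃ p ∈ S \ K, C = connectedComponentIn (S \ K) p) ∧
      ¬ ∃ L : Set (Euc m), IsCompact L ∧ L ⊆ S ∧ C ⊆ L

/-- The graph `S` with principal curvatures `κ` (in increasing order) is `C²`-asymptotic to the
cylinder `𝕊^{n-1}(r) × ℝ`: as `|p| → ∞` on `S`, the smallest principal curvature tends to `0` and
all the others tend to `1 / r`. -/
def IsAsymptoticToCylinder {n : ℕ} (S : Set (Euc (n + 1))) (κ : Euc (n + 1) → Fin n → ℝ)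
    (r : ℝ) : Prop :=
  ∀ i : Fin n, Tendsto (fun p => κ p i) (comap (fun p => ‖p‖) atTop ⊓ 𝓟 S)
    (𝓝 (if (i : ℕ) = 0 then 0 else 1 / r))

/-- `S` is rotationally symmetric about the `x_{n+1}`-axis: it is invariant under every linear
isometry of `ℝ^{n+1}` that fixes `e_{n+1}`. -/
def IsRotationallySymmetric {n : ℕ} (S : Set (Euc (n + 1))) : Prop :=
  ∀ A : Euc (n + 1) ≃ₗᵢ[ℝ] Euc (n + 1), A (eLast n) = eLast n → A '' S = S

/-- `S` is a `γ`-translator (in the direction `e_{n+1}`) given as the graph of `u`: at each of its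
points the principal curvature vector `λ` belongs to the domain `Γ` of `γ`, and
`γ(λ) = ⟨ν, e_{n+1}⟩`. -/
def IsGraphTranslator {n : ℕ} (Γ : Set (Fin n → ℝ)) (γ : (Fin n → ℝ) → ℝ) (u : Euc n → ℝ)
    (S : Set (Euc (n + 1))) : Prop :=
  ∀ p ∈ S, graphCurvatures u p ∈ Γ ∧
    γ (graphCurvatures u p) = inner ℝ (graphNormal u (baseProj p)) (eLast n)

end

/-! The proof reflects the graph in vertical hyperplanes and uses homogeneity of `γ` in place of a
strong maximum principle.

Positive curvatures make `u` convex, and completeness forces `u` to blow up at the boundary sphere: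
a bounded convex radial profile would have finite length and converge in the graph to a point over
the sphere. Hence sublevel sets are compact (`isCompact_sublevel`).

For a unit vector `e` and `t > 0`, let `ρ` be the reflection in `⟨x, e⟩ = t`. It maps the cap `⟨x,
e⟩ ≥ t` of the ball into the ball, and the claim is `u ∘ ρ ≤ u` on the cap (`reflected_le`). By
convexity, the part of the cap where this fails lies in a fixed sublevel set (`lt_of_lt_reflected`),
so no comparison near the sphere is needed. If the claim fails, then for `c < 1` close to `1` the
difference `u - c * u (c⁻¹ • ρ ·)` has an interior minimum. There the normals have equal vertical
components, while the curvatures of the graph are at least `c⁻¹` times those at the corresponding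
point. Monotonicity and homogeneity of `γ` make the speed strictly larger, against the translator
equation (`IsGraphTranslator.not_isLocalMin_sub_scaled`).

Letting `t → 0` and exchanging the two points gives equal values at points of equal norm, since
these are mirror images in a hyperplane through the origin. -/

/-! ### Linear algebra: simultaneous diagonalization and comparison of eigenvalues. -/

section LinearAlgebra

open scoped MatrixOrder in
/-- A positive definite real matrix has an invertible Gram factor. -/
lemma Matrix.PosDef.exists_transpose_mul_self {n : ℕ} {g : Matrix (Fin n) (Fin n) ℝ}
    (hg : g.PosDef) : ∃ B : Matrix (Fin n) (Fin n) ℝ, IsUnit B ∧ g = B.transpose * B := by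
  obtain ⟨B, hB⟩ := CStarAlgebra.nonneg_iff_eq_star_mul_self.mp hg.posSemidef.nonneg
  have hB' : g = B.transpose * B := by
    rw [hB, Matrix.star_eq_conjTranspose, Matrix.conjTranspose_eq_transpose_of_trivial]
  refine ⟨B, ?_, hB'⟩
  have h := hg.isUnit
  rw [hB'] at h
  exact isUnit_of_mul_isUnit_right h

/-- The roots of the characteristic polynomial of a matrix, in increasing order. -/
noncomputable def sortedCharpolyRoots {n : ℕ} (W : Matrix (Fin n) (Fin n) ℝ) : Fin n → ℝ :=
  fun i => (W.charpoly.roots.sort (· ≤ ·)).getD i 0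

lemma monotone_sortedCharpolyRoots_and_map {n : ℕ} {W : Matrix (Fin n) (Fin n) ℝ}
    (hW : W.charpoly.roots.card = n) :
    Monotone (sortedCharpolyRoots W) ∧
      Finset.univ.val.map (sortedCharpolyRoots W) = W.charpoly.roots := by
  have hlen : (W.charpoly.roots.sort (· ≤ ·)).length = n := by simp [hW]
  have hget : ∀ i : Fin n, sortedCharpolyRoots W i =
      (W.charpoly.roots.sort (· ≤ ·)).get (i.cast hlen.symm) := by
    intro i
    simp [sortedCharpolyRoots, hW]
  constructor
  · intro i j hij
    rw [hget, hget]
    exact (Multiset.pairwise_sort W.charpoly.roots (· ≤ ·)).sortedLE.monotone_get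
      (by simpa using hij)
  · rw [Fin.univ_val_map]
    conv_rhs => rw [← Multiset.sort_eq W.charpoly.roots (· ≤ ·)]
    congr 1
    apply List.ext_get
    · simp [hW]
    · intro k h1 h2
      simp only [List.get_eq_getElem, List.getElem_ofFn]
      rw [hget]
      simp

lemma exists_perm_of_map_univ_eq {n : ℕ} {f g : Fin n → ℝ} (hf : Monotone f)
    (h : Finset.univ.val.map f = Finset.univ.val.map g) : ∃ σ : Equiv.Perm (Fin n), f = g ∘ σ := by
  refine ⟨Tuple.sort g, ?_⟩
  have hperm : (List.ofFn f).Perm (List.ofFn (g ∘ Tuple.sort g)) := by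
    rw [Fin.univ_val_map, Fin.univ_val_map, Multiset.coe_eq_coe] at h
    exact List.Perm.trans h ((Tuple.sort g).ofFn_comp_perm g).symm
  exact List.ofFn_injective (List.Perm.eq_of_sortedLE hf.sortedLE_ofFn
    (Tuple.monotone_sort g).sortedLE_ofFn hperm)

/-- Simultaneous diagonalization of a pair of symmetric matrices, the first one positive
definite. -/
lemma exists_simultaneous_diagonalization {n : ℕ} {g h : Matrix (Fin n) (Fin n) ℝ}
    (hg : g.PosDef) (hh : h.IsHermitian) :
    Monotone (sortedCharpolyRoots (g⁻¹ * h)) ∧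
    ∃ P : Matrix (Fin n) (Fin n) ℝ, IsUnit P ∧ P.transpose * g * P = 1 ∧
      P.transpose * h * P = Matrix.diagonal (sortedCharpolyRoots (g⁻¹ * h)) := by
  obtain ⟨B, hBu, rfl⟩ := hg.exists_transpose_mul_self
  have hBd : IsUnit B.det := (Matrix.isUnit_iff_isUnit_det B).mp hBu
  set C := B⁻¹ with hC
  have hBC : B * C = 1 := Matrix.mul_nonsing_inv B hBd
  have hCB : C * B = 1 := Matrix.nonsing_inv_mul B hBd
  have hCtBt : C.transpose * B.transpose = 1 := by
    rw [← Matrix.transpose_mul, hBC, Matrix.transpose_one]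
  set A := C.transpose * h * C with hAdef
  have hA : A.IsHermitian := by
    have := Matrix.isHermitian_conjTranspose_mul_mul C hh
    rwa [Matrix.conjTranspose_eq_transpose_of_trivial] at this
  -- `g⁻¹ * h = C * Cᵀ * h` need not be symmetric, but moving the factor `C` to the right end turns
  -- it into the symmetric `A` without changing the characteristic polynomial.
  have hchar : ((B.transpose * B)⁻¹ * h).charpoly = A.charpoly := by
    rw [Matrix.mul_inv_rev, ← hC, Matrix.inv_eq_left_inv hCtBt, mul_assoc,
      Matrix.charpoly_mul_comm]
  have hroots : ((B.transpose * B)⁻¹ * h).charpoly.roots =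
      Finset.univ.val.map hA.eigenvalues := by
    rw [hchar, hA.roots_charpoly_eq_eigenvalues]
    rfl
  have hcard : ((B.transpose * B)⁻¹ * h).charpoly.roots.card = n := by
    rw [hroots]; simp
  obtain ⟨hmono, hmap⟩ := monotone_sortedCharpolyRoots_and_map hcard
  refine ⟨hmono, ?_⟩
  rw [hroots] at hmap
  obtain ⟨σ, hσ⟩ := exists_perm_of_map_univ_eq hmono hmap
  set U : Matrix (Fin n) (Fin n) ℝ := hA.eigenvectorUnitary.1 with hU
  have hUU : U.transpose * U = 1 := by
    have := Matrix.mem_unitaryGroup_iff'.mp hA.eigenvectorUnitary.2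
    rwa [Matrix.star_eq_conjTranspose, Matrix.conjTranspose_eq_transpose_of_trivial] at this
  have hUA : U.transpose * A * U = Matrix.diagonal hA.eigenvalues := by
    have := hA.conjStarAlgAut_star_eigenvectorUnitary
    simpa [Unitary.conjStarAlgAut_apply, Matrix.star_eq_conjTranspose,
      Matrix.conjTranspose_eq_transpose_of_trivial] using this
  have hUu : IsUnit U := IsUnit.of_mul_eq_one_right _ hUU
  have hCu : IsUnit C := IsUnit.of_mul_eq_one _ hCB
  have key : ∀ k : Matrix (Fin n) (Fin n) ℝ,
      ((C * U).submatrix id σ).transpose * k * (C * U).submatrix id σ =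
        (U.transpose * (C.transpose * k * C) * U).submatrix σ σ := by
    intro k
    rw [Matrix.transpose_submatrix, Matrix.transpose_mul]
    have : U.transpose * (C.transpose * k * C) * U =
        U.transpose * C.transpose * k * (C * U) := by simp only [mul_assoc]
    rw [this]
    rfl
  -- The columns of `C * U` are permuted by `σ` so that the eigenvalues appear on the diagonal in
  -- increasing order.
  refine ⟨(C * U).submatrix id σ, ?_, ?_, ?_⟩
  · have := hCu.mul hUu
    rw [Matrix.isUnit_iff_isUnit_det] at this ⊢
    rw [Matrix.det_permute']
    exact IsUnit.mul ((Equiv.Perm.sign σ).isUnit.map (Int.castRingHom ℝ)) this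
  · rw [key]
    have : C.transpose * (B.transpose * B) * C = 1 := by
      rw [← mul_assoc, hCtBt, one_mul, hBC]
    rw [this, mul_one, hUU, Matrix.submatrix_one_equiv]
  · rw [key, ← hAdef, hUA, Matrix.submatrix_diagonal_equiv, hσ]

/-- Monotonicity of the eigenvalues: if `T` is orthogonal and the quadratic form with ordered
eigenvalues `μ` is dominated, after composition with `T`, by the one with ordered eigenvalues `l`,
then `μ ≤ l`. -/
lemma eigenvalues_le_of_quadratic_le {n : ℕ} (T : (Fin n → ℝ) ≃ₗ[ℝ] (Fin n → ℝ))
    {l μ : Fin n → ℝ} (hl : Monotone l) (hμ : Monotone μ)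
    (hT : ∀ a, ∑ i, T a i ^ 2 = ∑ i, a i ^ 2)
    (hle : ∀ a, ∑ i, μ i * T a i ^ 2 ≤ ∑ i, l i * a i ^ 2) (k : Fin n) : μ k ≤ l k := by
  -- Courant–Fischer by counting: `T a i = 0` for `i < k` and `a i = 0` for `i > k` are only `n - 1`
  -- conditions. The zero put in slot `k` keeps `L` from being surjective, hence from being
  -- injective.
  let L : (Fin n → ℝ) →ₗ[ℝ] (Fin n → ℝ) := LinearMap.pi fun i =>
    if i < k then (LinearMap.proj i).comp T.toLinearMap
    else if i = k then 0 else LinearMap.proj i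
  have hL : ¬ Function.Injective L := by
    intro hinj
    obtain ⟨a, ha⟩ := (LinearMap.injective_iff_surjective.mp hinj) (Pi.single k 1)
    have := congrFun ha k
    simp [L] at this
  obtain ⟨a, ha, ha0⟩ : ∃ a, L a = 0 ∧ a ≠ 0 := by
    by_contra! hcon
    exact hL ((injective_iff_map_eq_zero L).mpr hcon)
  have h1 : ∀ i, i < k → T a i = 0 := by
    intro i hi
    have := congrFun ha i
    simpa [L, hi] using this
  have h2 : ∀ i, k < i → a i = 0 := by
    intro i hi
    have := congrFun ha i
    simpa [L, hi.not_gt, hi.ne'] using this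
  have hpos : 0 < ∑ i, a i ^ 2 := by
    obtain ⟨i, hi⟩ := Function.ne_iff.mp ha0
    exact Finset.sum_pos' (fun _ _ => sq_nonneg _) ⟨i, Finset.mem_univ _, by
      have : a i ≠ 0 := hi
      positivity⟩
  have hlow : μ k * ∑ i, T a i ^ 2 ≤ ∑ i, μ i * T a i ^ 2 := by
    rw [Finset.mul_sum]
    refine Finset.sum_le_sum fun i _ => ?_
    rcases lt_or_ge i k with h | h
    · simp [h1 i h]
    · exact mul_le_mul_of_nonneg_right (hμ h) (sq_nonneg _)
  have hup : ∑ i, l i * a i ^ 2 ≤ l k * ∑ i, a i ^ 2 := by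
    rw [Finset.mul_sum]
    refine Finset.sum_le_sum fun i _ => ?_
    rcases lt_or_ge k i with h | h
    · simp [h2 i h]
    · exact mul_le_mul_of_nonneg_right (hl h) (sq_nonneg _)
  rw [hT] at hlow
  exact le_of_mul_le_mul_right (hlow.trans ((hle a).trans hup)) hpos

end LinearAlgebra

/-! ### Geometry of graphs: fundamental forms and principal frames. -/

section GraphGeometry

variable {n : ℕ}

/-- The inclusion `ℝ^n = ℝ^n × {0} ⊆ ℝ^{n+1}`. -/
noncomputable def horizontalIncl (n : ℕ) : Euc n →L[ℝ] Euc (n + 1) :=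
  LinearMap.toContinuousLinearMap
    { toFun := fun v => WithLp.toLp 2 (Fin.snoc (α := fun _ => ℝ) (fun i => v i) 0)
      map_add' := fun v w => by
        ext i
        refine Fin.lastCases ?_ (fun j => ?_) i <;> simp
      map_smul' := fun c v => by
        ext i
        refine Fin.lastCases ?_ (fun j => ?_) i <;> simp }

@[simp] lemma horizontalIncl_last (v : Euc n) : horizontalIncl n v (Fin.last n) = 0 := by
  simp [horizontalIncl]

@[simp] lemma horizontalIncl_castSucc (v : Euc n) (i : Fin n) :
    horizontalIncl n v i.castSucc = v i := by
  simp [horizontalIncl]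

@[simp] lemma eLast_last : eLast n (Fin.last n) = 1 := by simp [eLast]

@[simp] lemma eLast_castSucc (i : Fin n) : eLast n i.castSucc = 0 := by
  simp [eLast, (Fin.castSucc_lt_last i).ne]

lemma inner_horizontalIncl (v w : Euc n) :
    inner ℝ (horizontalIncl n v) (horizontalIncl n w) = inner ℝ v w := by
  simp [PiLp.inner_apply, Fin.sum_univ_castSucc]

lemma inner_horizontalIncl_eLast (v : Euc n) : inner ℝ (horizontalIncl n v) (eLast n) = 0 := by
  simp [PiLp.inner_apply, Fin.sum_univ_castSucc]

lemma inner_eLast_horizontalIncl (v : Euc n) : inner ℝ (eLast n) (horizontalIncl n v) = 0 := by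
  simp [PiLp.inner_apply, Fin.sum_univ_castSucc]

lemma inner_eLast_eLast : inner ℝ (eLast n) (eLast n) = 1 := by
  simp [eLast]

lemma graphMap_eq (u : Euc n → ℝ) (x : Euc n) :
    graphMap u x = horizontalIncl n x + u x • eLast n := by
  ext i
  refine Fin.lastCases ?_ (fun j => ?_) i <;> simp [graphMap]

lemma graphNormal_eq (u : Euc n → ℝ) (x : Euc n) :
    graphNormal u x = (Real.sqrt (1 + ‖fderiv ℝ u x‖ ^ 2))⁻¹ •
      (eLast n - horizontalIncl n (gradient u x)) := by
  have h : ‖gradient u x‖ = ‖fderiv ℝ u x‖ := by simp [gradient]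
  rw [graphNormal, h]
  congr 1
  ext i
  refine Fin.lastCases ?_ (fun j => ?_) i <;> simp

@[simp] lemma baseProj_graphMap (u : Euc n → ℝ) (x : Euc n) : baseProj (graphMap u x) = x := by
  ext i
  simp [baseProj, graphMap]

lemma inner_graphNormal_eLast (u : Euc n → ℝ) (x : Euc n) :
    inner ℝ (graphNormal u x) (eLast n) = (Real.sqrt (1 + ‖fderiv ℝ u x‖ ^ 2))⁻¹ := by
  rw [graphNormal_eq, real_inner_smul_left, inner_sub_left, inner_eLast_eLast,
    inner_horizontalIncl_eLast]
  ring

lemma tangentVec_graphMap {u : Euc n → ℝ} {x : Euc n} (hu : DifferentiableAt ℝ u x) (i : Fin n) :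
    tangentVec (graphMap u) x i = horizontalIncl n (EuclideanSpace.single i 1) +
      fderiv ℝ u x (EuclideanSpace.single i 1) • eLast n := by
  have h : HasFDerivAt (graphMap u)
      (horizontalIncl n + (fderiv ℝ u x).smulRight (eLast n)) x := by
    have := (horizontalIncl n).hasFDerivAt (x := x) |>.add (hu.hasFDerivAt.smul_const (eLast n))
    refine this.congr_of_eventuallyEq (Eventually.of_forall fun y => graphMap_eq u y)
  rw [tangentVec, h.fderiv]
  simp

lemma secondDeriv_graphMap {u : Euc n → ℝ} {x : Euc n} (hu : ContDiffAt ℝ 2 u x) (i j : Fin n) :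
    secondDeriv (graphMap u) x i j =
      fderiv ℝ (fderiv ℝ u) x (EuclideanSpace.single i 1) (EuclideanSpace.single j 1) •
        eLast n := by
  have hd : DifferentiableAt ℝ (fderiv ℝ u) x :=
    (hu.fderiv_right (m := 1) (by norm_num)).differentiableAt (by norm_num)
  have hev : (fun y => tangentVec (graphMap u) y j) =ᶠ[𝓝 x] fun y =>
      horizontalIncl n (EuclideanSpace.single j 1) +
        fderiv ℝ u y (EuclideanSpace.single j 1) • eLast n := by
    filter_upwards [hu.eventually (by norm_num)] with y hy
    exact tangentVec_graphMap (hy.differentiableAt (by norm_num)) j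
  have h := ((hd.hasFDerivAt.clm_apply (hasFDerivAt_const (EuclideanSpace.single j (1 : ℝ)) x)
    ).smul_const (eLast n)).const_add (horizontalIncl n (EuclideanSpace.single j 1))
  rw [secondDeriv, (h.congr_of_eventuallyEq hev).fderiv]
  simp

lemma sum_smul_single (v : Euc n) : ∑ i, v i • EuclideanSpace.single i (1 : ℝ) = v := by
  have := (EuclideanSpace.basisFun (Fin n) ℝ).sum_repr v
  simpa using this

/-- The tangent vector over `v` is `(v, Du(v))`, and the metric is its squared length; positive
definiteness can be read off. -/
lemma dotProduct_metricMatrix_mulVec {u : Euc n → ℝ} {x : Euc n} (hu : DifferentiableAt ℝ u x)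
    (v : Euc n) : dotProduct v.ofLp (metricMatrix (graphMap u) x |>.mulVec v.ofLp) =
      ‖v‖ ^ 2 + fderiv ℝ u x v ^ 2 := by
  have hsum : ∑ i, v i • tangentVec (graphMap u) x i =
      horizontalIncl n v + fderiv ℝ u x v • eLast n := by
    simp_rw [tangentVec_graphMap hu, smul_add, Finset.sum_add_distrib, smul_smul,
      ← Finset.sum_smul, ← map_smul, ← smul_eq_mul, ← map_smul, ← map_sum, sum_smul_single]
  have : dotProduct v.ofLp (metricMatrix (graphMap u) x |>.mulVec v.ofLp) =
      inner ℝ (∑ i, v i • tangentVec (graphMap u) x i)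
        (∑ i, v i • tangentVec (graphMap u) x i) := by
    simp only [dotProduct, Matrix.mulVec, metricMatrix, Matrix.of_apply, sum_inner, inner_sum,
      real_inner_smul_left, real_inner_smul_right, Finset.mul_sum]
    rw [Finset.sum_comm]
    refine Finset.sum_congr rfl fun i _ => Finset.sum_congr rfl fun j _ => ?_
    rw [real_inner_comm]
    ring
  rw [this, hsum, ← real_inner_self_eq_norm_sq v]
  simp only [inner_add_left, inner_add_right, real_inner_smul_left, real_inner_smul_right,
    inner_horizontalIncl, inner_horizontalIncl_eLast, inner_eLast_horizontalIncl,
    inner_eLast_eLast]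
  ring

lemma secondFundForm_graph_apply {u : Euc n → ℝ} {x : Euc n} (hu : ContDiffAt ℝ 2 u x)
    (i j : Fin n) : secondFundForm (graphMap u) (graphNormal u) x i j =
      (Real.sqrt (1 + ‖fderiv ℝ u x‖ ^ 2))⁻¹ *
        fderiv ℝ (fderiv ℝ u) x (EuclideanSpace.single i 1) (EuclideanSpace.single j 1) := by
  rw [secondFundForm, Matrix.of_apply, secondDeriv_graphMap hu, real_inner_smul_left,
    real_inner_comm, inner_graphNormal_eLast, mul_comm]

lemma dotProduct_secondFundForm_mulVec {u : Euc n → ℝ} {x : Euc n} (hu : ContDiffAt ℝ 2 u x)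
    (v : Euc n) :
    dotProduct v.ofLp (secondFundForm (graphMap u) (graphNormal u) x |>.mulVec v.ofLp) =
      (Real.sqrt (1 + ‖fderiv ℝ u x‖ ^ 2))⁻¹ * fderiv ℝ (fderiv ℝ u) x v v := by
  conv_rhs => rw [← sum_smul_single v]
  simp only [dotProduct, Matrix.mulVec, secondFundForm_graph_apply hu, map_sum, map_smul,
    sum_apply, smul_apply, Finset.mul_sum, smul_eq_mul]
  rw [Finset.sum_comm]
  refine Finset.sum_congr rfl fun i _ => Finset.sum_congr rfl fun j _ => ?_
  ring

/-- A frame of the tangent space of a graph that is orthonormal and diagonalizes the second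
fundamental form. -/
lemma exists_principal_frame {u : Euc n → ℝ} {x : Euc n} (hu : ContDiffAt ℝ 2 u x) :
    Monotone (principalCurvatures (graphMap u) (graphNormal u) x) ∧
    ∃ E : (Fin n → ℝ) ≃ₗ[ℝ] Euc n,
      (∀ a, ‖E a‖ ^ 2 + fderiv ℝ u x (E a) ^ 2 = ∑ i, a i ^ 2) ∧
      ∀ a, (Real.sqrt (1 + ‖fderiv ℝ u x‖ ^ 2))⁻¹ * fderiv ℝ (fderiv ℝ u) x (E a) (E a) =
        ∑ i, principalCurvatures (graphMap u) (graphNormal u) x i * a i ^ 2 := by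
  have hud : DifferentiableAt ℝ u x := hu.differentiableAt (by norm_num)
  have hg : (metricMatrix (graphMap u) x).PosDef := by
    refine Matrix.PosDef.of_dotProduct_mulVec_pos ?_ fun v hv => ?_
    · ext i j
      simp [metricMatrix, real_inner_comm]
    · have h := dotProduct_metricMatrix_mulVec hud (WithLp.toLp 2 v)
      have hv' : 0 < ‖WithLp.toLp 2 v‖ := by
        rw [norm_pos_iff]
        exact fun h0 => hv (by simpa using congrArg WithLp.ofLp h0)
      simp only [star_trivial]
      simp only at h
      rw [h]
      positivity
  have hh : (secondFundForm (graphMap u) (graphNormal u) x).IsHermitian := by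
    ext i j
    simp only [Matrix.conjTranspose_apply, star_trivial, secondFundForm_graph_apply hu]
    rw [(hu.isSymmSndFDerivAt (by simp)).eq]
  obtain ⟨hmono, P, hP, hPg, hPh⟩ := exists_simultaneous_diagonalization hg hh
  refine ⟨hmono, ?_⟩
  let E : (Fin n → ℝ) ≃ₗ[ℝ] Euc n :=
    (Matrix.toLinearEquiv' P hP.invertible).trans (WithLp.linearEquiv 2 ℝ (Fin n → ℝ)).symm
  have hE : ∀ a, (E a).ofLp = P.mulVec a := fun a => rfl
  have hquad : ∀ (k : Matrix (Fin n) (Fin n) ℝ) (a : Fin n → ℝ),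
      dotProduct (E a).ofLp (k.mulVec (E a).ofLp) =
        dotProduct a ((P.transpose * k * P).mulVec a) := by
    intro k a
    rw [hE, ← Matrix.mulVec_mulVec, ← Matrix.mulVec_mulVec, Matrix.dotProduct_mulVec a,
      Matrix.vecMul_transpose]
  refine ⟨E, fun a => ?_, fun a => ?_⟩
  · rw [← dotProduct_metricMatrix_mulVec hud, hquad, hPg]
    simp [dotProduct, sq]
  · rw [← dotProduct_secondFundForm_mulVec hu, hquad, hPh]
    simp only [dotProduct, Matrix.mulVec_diagonal]
    refine Finset.sum_congr rfl fun i _ => ?_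
    change a i * (principalCurvatures (graphMap u) (graphNormal u) x i * a i) = _
    ring

/-- Comparison of the principal curvatures of two graphs whose tangent planes correspond to each
other under a linear isometry `R`. -/
lemma smul_principalCurvatures_le {u : Euc n → ℝ} {x y : Euc n} (hx : ContDiffAt ℝ 2 u x)
    (hy : ContDiffAt ℝ 2 u y) (R : Euc n ≃ₗᵢ[ℝ] Euc n) {k : ℝ} (hk : 0 ≤ k)
    (h1 : ∀ v, fderiv ℝ u x v = fderiv ℝ u y (R v))
    (h2 : ∀ v, k * fderiv ℝ (fderiv ℝ u) y (R v) (R v) ≤ fderiv ℝ (fderiv ℝ u) x v v)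
    (i : Fin n) :
    k * principalCurvatures (graphMap u) (graphNormal u) y i ≤
      principalCurvatures (graphMap u) (graphNormal u) x i := by
  obtain ⟨mx, E, hE1, hE2⟩ := exists_principal_frame hx
  obtain ⟨my, F, hF1, hF2⟩ := exists_principal_frame hy
  have hnorm : ‖fderiv ℝ u x‖ = ‖fderiv ℝ u y‖ := by
    have : fderiv ℝ u x = (fderiv ℝ u y).comp (R.toContinuousLinearEquiv : Euc n →L[ℝ] Euc n) := by
      ext v
      exact h1 v
    rw [this]
    exact ContinuousLinearMap.opNorm_comp_linearIsometryEquiv _ R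
  -- `T` is `R` written in the two principal frames. It is orthogonal because both frames are
  -- orthonormal and, by `h1`, `R` preserves the induced metrics.
  let T : (Fin n → ℝ) ≃ₗ[ℝ] (Fin n → ℝ) := (E.trans R.toLinearEquiv).trans F.symm
  have hT : ∀ a, F (T a) = R (E a) := fun a => by simp [T]
  refine eigenvalues_le_of_quadratic_le T mx (my.const_mul hk) (fun a => ?_) (fun a => ?_) i
  · rw [← hF1, ← hE1, hT, R.norm_map, ← h1]
  · rw [← hE2]
    simp only [mul_assoc]
    rw [← Finset.mul_sum, ← hF2, hT, hnorm, mul_left_comm]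
    exact mul_le_mul_of_nonneg_left (h2 _) (by positivity)

/-- A graph with positive principal curvatures has a positive semidefinite Hessian. -/
lemma hessian_nonneg_of_principalCurvatures_pos {u : Euc n → ℝ} {x : Euc n}
    (hu : ContDiffAt ℝ 2 u x)
    (hpos : ∀ i, 0 < principalCurvatures (graphMap u) (graphNormal u) x i) (v : Euc n) :
    0 ≤ fderiv ℝ (fderiv ℝ u) x v v := by
  obtain ⟨-, E, -, hE⟩ := exists_principal_frame hu
  have h := hE (E.symm v)
  rw [E.apply_symm_apply] at h
  have hs : 0 < (Real.sqrt (1 + ‖fderiv ℝ u x‖ ^ 2))⁻¹ := by positivity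
  have : 0 ≤ (Real.sqrt (1 + ‖fderiv ℝ u x‖ ^ 2))⁻¹ * fderiv ℝ (fderiv ℝ u) x v v := by
    rw [h]
    exact Finset.sum_nonneg fun i _ => mul_nonneg (hpos i).le (sq_nonneg _)
  exact nonneg_of_mul_nonneg_right this hs

end GraphGeometry

/-! ### Intrinsic distance and curves of finite length. -/

section IntrinsicDistance

variable {m : ℕ}

lemma edist_le_intrinsicEDist (S : Set (Euc m)) (p q : Euc m) :
    edist p q ≤ intrinsicEDist S p q := by
  refine le_iInf fun c => le_iInf fun hc => ?_
  rw [← hc.2.2.1, ← hc.2.2.2]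
  exact eVariationOn.edist_le c (by simp) (by simp)

/-- Affine reparametrization to `[0, 1]`, forwards and backwards; having both orders avoids a
separate proof that the distance is symmetric. -/
lemma intrinsicEDist_le_eVariationOn {S : Set (Euc m)} {c : ℝ → Euc m} {a b : ℝ} (hab : a ≤ b)
    (hc : ContinuousOn c (Icc a b)) (hS : MapsTo c (Icc a b) S) :
    intrinsicEDist S (c a) (c b) ≤ eVariationOn c (Icc a b) ∧
      intrinsicEDist S (c b) (c a) ≤ eVariationOn c (Icc a b) := by
  have h1 : MapsTo (fun t : ℝ => a + t * (b - a)) (Icc 0 1) (Icc a b) := fun t ht =>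
    ⟨by nlinarith [ht.1, ht.2], by nlinarith [ht.1, ht.2]⟩
  have h2 : MapsTo (fun t : ℝ => b - t * (b - a)) (Icc 0 1) (Icc a b) := fun t ht =>
    ⟨by nlinarith [ht.1, ht.2], by nlinarith [ht.1, ht.2]⟩
  constructor
  · refine (iInf₂_le (c ∘ fun t : ℝ => a + t * (b - a))
      ⟨hc.comp (by fun_prop) h1, hS.comp h1, by simp, by simp⟩).trans ?_
    exact eVariationOn.comp_le_of_monotoneOn c _ (fun s _ t _ hst => by
      nlinarith) h1
  · refine (iInf₂_le (c ∘ fun t : ℝ => b - t * (b - a))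
      ⟨hc.comp (by fun_prop) h2, hS.comp h2, by simp, by simp⟩).trans ?_
    exact eVariationOn.comp_le_of_antitoneOn c _ (fun s _ t _ hst => by
      nlinarith) h2

/-- `θ` acts as a majorant of arc length: it is monotone, so its own variation telescopes. -/
lemma eVariationOn_le_of_dist_le {E : Type*} [PseudoMetricSpace E] {c : ℝ → E} {θ : ℝ → ℝ}
    {a b : ℝ} (hab : a ≤ b)
    (h : ∀ s ∈ Icc a b, ∀ t ∈ Icc a b, s ≤ t → dist (c s) (c t) ≤ θ t - θ s) :
    eVariationOn c (Icc a b) ≤ ENNReal.ofReal (θ b - θ a) := by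
  have hmono : MonotoneOn θ (Icc a b) := fun s hs t ht hst => by
    linarith [h s hs t ht hst, dist_nonneg (x := c s) (y := c t)]
  have h2 : eVariationOn θ (Icc a b) ≤ ENNReal.ofReal (θ b - θ a) := by
    have := (hmono.eVariationOn_eq (left_mem_Icc.mpr hab) (right_mem_Icc.mpr hab)).le
    rwa [inter_self] at this
  refine le_trans (iSup_mono fun p => Finset.sum_le_sum fun i _ => ?_) h2
  rw [edist_comm, edist_comm (θ _), edist_dist, edist_dist]
  refine ENNReal.ofReal_le_ofReal ((h _ (p.2.2.2 i) _ (p.2.2.2 (i + 1))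
    (p.2.2.1 (Nat.le_succ i))).trans ?_)
  rw [Real.dist_eq, abs_sub_comm]
  exact le_abs_self _

/-- In an intrinsically complete set, a curve of finite length defined on a half-open interval
converges to a point of the set. -/
lemma IsIntrinsicallyComplete.exists_tendsto {S : Set (Euc m)} (hS : IsIntrinsicallyComplete S)
    {c : ℝ → Euc m} {θ : ℝ → ℝ} {a b C : ℝ} (hab : a < b) (hc : ContinuousOn c (Ico a b))
    (hcS : MapsTo c (Ico a b) S)
    (h : ∀ s ∈ Ico a b, ∀ t ∈ Ico a b, s ≤ t → dist (c s) (c t) ≤ θ t - θ s)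
    (hC : ∀ s ∈ Ico a b, θ s ≤ C) :
    ∃ q ∈ S, ∃ s : ℕ → ℝ, (∀ k, s k ∈ Ico a b) ∧ Tendsto s atTop (𝓝 b) ∧
      Tendsto (fun k => c (s k)) atTop (𝓝 q) := by
  obtain ⟨s, hsmono, hs, hslim⟩ := exists_seq_strictMono_tendsto' hab
  have hs' : ∀ k, s k ∈ Ico a b := fun k => ⟨(hs k).1.le, (hs k).2⟩
  have hθ : Monotone fun k => θ (s k) := fun j k hjk => by
    linarith [h _ (hs' j) _ (hs' k) (hsmono.monotone hjk), dist_nonneg (x := c (s j)) (y := c (s k))]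
  -- Monotone and bounded above, the values `θ (s k)` converge; their differences dominate the
  -- intrinsic distances along the curve.
  have hcauchy : CauchySeq fun k => θ (s k) :=
    (tendsto_atTop_ciSup hθ ⟨C, by rintro _ ⟨k, rfl⟩; exact hC _ (hs' k)⟩).cauchySeq
  have hbound : ∀ j k, intrinsicEDist S (c (s j)) (c (s k)) ≤ edist (θ (s j)) (θ (s k)) := by
    have key : ∀ j k, j ≤ k → intrinsicEDist S (c (s j)) (c (s k)) ≤ edist (θ (s j)) (θ (s k)) ∧
        intrinsicEDist S (c (s k)) (c (s j)) ≤ edist (θ (s j)) (θ (s k)) := by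
      intro j k hjk
      have hsub : Icc (s j) (s k) ⊆ Ico a b := fun t ht =>
        ⟨(hs' j).1.trans ht.1, ht.2.trans_lt (hs' k).2⟩
      have hle := hsmono.monotone hjk
      have h1 := intrinsicEDist_le_eVariationOn hle (hc.mono hsub) (hcS.mono_left hsub)
      have h2 := eVariationOn_le_of_dist_le hle fun s hs t ht => h s (hsub hs) t (hsub ht)
      have h3 : ENNReal.ofReal (θ (s k) - θ (s j)) ≤ edist (θ (s j)) (θ (s k)) := by
        rw [edist_dist, dist_comm]
        exact ENNReal.ofReal_le_ofReal (le_abs_self _)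
      exact ⟨h1.1.trans (h2.trans h3), h1.2.trans (h2.trans h3)⟩
    intro j k
    rcases le_total j k with hjk | hjk
    · exact (key j k hjk).1
    · rw [edist_comm]
      exact (key k j hjk).2
  obtain ⟨q, hq, hlim⟩ := hS (fun k => c (s k)) (fun k => hcS (hs' k)) fun ε hε => by
    obtain ⟨N, hN⟩ := EMetric.cauchySeq_iff.mp hcauchy ε hε
    exact ⟨N, fun j hj k hk => (hbound j k).trans_lt (hN j hj k hk)⟩
  refine ⟨q, hq, s, hs', hslim, ?_⟩
  rw [tendsto_iff_edist_tendsto_0]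
  exact tendsto_of_tendsto_of_tendsto_of_le_of_le tendsto_const_nhds hlim (fun _ => zero_le)
    fun k => edist_le_intrinsicEDist _ _ _

end IntrinsicDistance

/-! ### Completeness makes the convex function proper. -/

section Properness

variable {n : ℕ} {u : Euc n → ℝ} {r : ℝ}

lemma smul_mem_ball_of_mem_Ico {x : Euc n} (hr : 0 < r) (hx : ‖x‖ ≤ r) {s : ℝ}
    (hs : s ∈ Ico (0 : ℝ) 1) : s • x ∈ ball (0 : Euc n) r := by
  rw [mem_ball_zero_iff, norm_smul, Real.norm_of_nonneg hs.1]
  nlinarith [hs.1, hs.2, norm_nonneg x]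

/-- A convex function with intrinsically complete graph over a ball is unbounded along each
radius. -/
lemma not_bddAbove_radial (hr : 0 < r) (hconv : ConvexOn ℝ (ball 0 r) u)
    (hcont : ContinuousOn u (ball 0 r))
    (hcomplete : IsIntrinsicallyComplete (graphMap u '' ball 0 r)) {x : Euc n} (hx : ‖x‖ = r)
    {M : ℝ} (hM : ∀ s ∈ Ico (0 : ℝ) 1, u (s • x) ≤ M) : False := by
  set φ : ℝ → ℝ := fun s => u (s • x) with hφ
  have hmaps : MapsTo (fun s : ℝ => s • x) (Ico 0 1) (ball 0 r) := fun s hs =>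
    smul_mem_ball_of_mem_Ico hr hx.le hs
  have hφc : ConvexOn ℝ (Ico 0 1) φ := by
    refine ⟨convex_Ico 0 1, fun s hs t ht a b ha hb hab => ?_⟩
    have := hconv.2 (hmaps hs) (hmaps ht) ha hb hab
    simpa only [hφ, smul_eq_mul, add_smul, mul_smul] using this
  have hφcont : ContinuousOn φ (Ico 0 1) := hcont.comp (by fun_prop) hmaps
  -- By convexity, slopes of `φ` beyond `1 / 2` are at least the slope over `[0, 1/2]`, hence at
  -- least `-l`.
  set l : ℝ := |(φ (1 / 2) - φ 0) / (1 / 2 - 0)| with hl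
  have hslope : ∀ s ∈ Ico (1 / 2 : ℝ) 1, ∀ t ∈ Ico (1 / 2 : ℝ) 1, s ≤ t →
      -l * (t - s) ≤ φ t - φ s := by
    intro s hs t ht hst
    rcases hst.eq_or_lt with rfl | hst
    · simp
    have h0 : (0 : ℝ) ∈ Ico (0 : ℝ) 1 := by norm_num
    have ht' : t ∈ Ico (0 : ℝ) 1 := ⟨by linarith [ht.1], ht.2⟩
    have hs' : s ∈ Ico (0 : ℝ) 1 := ⟨by linarith [hs.1], hs.2⟩
    have key : (φ (1 / 2) - φ 0) / (1 / 2 - 0) ≤ (φ t - φ s) / (t - s) := by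
      rcases hs.1.eq_or_lt with h | h
      · rw [← h] at hst ⊢
        exact hφc.slope_mono_adjacent h0 ht' (by norm_num) hst
      · have hh : (1 / 2 : ℝ) ∈ Ico (0 : ℝ) 1 := by norm_num
        exact (hφc.slope_mono_adjacent h0 hs' (by norm_num) h).trans
          (hφc.slope_mono_adjacent hh ht' h hst)
    have h3 := (neg_abs_le _).trans key
    rwa [le_div_iff₀ (by linarith)] at h3
  have hl0 : 0 ≤ l := abs_nonneg _
  -- Length majorant: the horizontal motion costs `r * (t - s)`, and `φ t - φ s ≥ -l * (t - s)`
  -- gives `|φ t - φ s| ≤ φ t - φ s + 2 * l * (t - s)`. An upper bound for `φ` therefore bounds `θ`.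
  let θ : ℝ → ℝ := fun s => φ s + (2 * l + r) * s
  have hcS : MapsTo (fun s : ℝ => graphMap u (s • x)) (Ico (1 / 2) 1)
      (graphMap u '' ball 0 r) := fun s hs =>
    mem_image_of_mem _ (hmaps ⟨by linarith [hs.1], hs.2⟩)
  have hccont : ContinuousOn (fun s : ℝ => graphMap u (s • x)) (Ico (1 / 2) 1) := by
    simp only [graphMap_eq]
    exact ((horizontalIncl n).continuous.comp (by fun_prop)).continuousOn.add
      ((hφcont.mono (Ico_subset_Ico_left (by norm_num))).smul continuousOn_const)
  obtain ⟨q, ⟨y, hy, rfl⟩, s, hs, hslim, hlim⟩ :=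
    hcomplete.exists_tendsto (θ := θ) (C := M + (2 * l + r)) (by norm_num) hccont hcS
    (fun s hs t ht hst => by
      have h1 := hslope s hs t ht hst
      have h2 : graphMap u (s • x) - graphMap u (t • x) =
          (s - t) • horizontalIncl n x + (φ s - φ t) • eLast n := by
        simp only [graphMap_eq, map_smul, hφ]
        module
      have h3 : ‖horizontalIncl n x‖ = r := by
        rw [← hx, ← sq_eq_sq₀ (norm_nonneg _) (norm_nonneg _), ← real_inner_self_eq_norm_sq,
          ← real_inner_self_eq_norm_sq, inner_horizontalIncl]
      have h4 : ‖eLast n‖ = 1 := by simp [eLast]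
      rw [dist_eq_norm, h2]
      refine (norm_add_le _ _).trans ?_
      rw [norm_smul, norm_smul, h3, h4, Real.norm_eq_abs, Real.norm_eq_abs, abs_sub_comm,
        abs_of_nonneg (by linarith : (0 : ℝ) ≤ t - s)]
      have h5 : |φ s - φ t| ≤ φ t - φ s + 2 * l * (t - s) :=
        abs_le.mpr ⟨by nlinarith, by nlinarith⟩
      simp only [θ]
      linarith)
    (fun s hs => by
      have := hM s ⟨by linarith [hs.1], hs.2⟩
      simp only [θ]
      nlinarith [hs.2, hs.1])
  have hproj : Continuous (baseProj : Euc (n + 1) → Euc n) := by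
    unfold baseProj
    fun_prop
  have h1 : Tendsto (fun k => s k • x) atTop (𝓝 y) := by
    have := (hproj.tendsto _).comp hlim
    simpa [Function.comp_def] using this
  have h2 : Tendsto (fun k => s k • x) atTop (𝓝 x) := by
    simpa using hslim.smul_const x
  rw [tendsto_nhds_unique h1 h2, mem_ball_zero_iff, hx] at hy
  exact lt_irrefl _ hy

/-- A convex function on a ball whose graph is intrinsically complete is proper. -/
lemma isCompact_sublevel (hr : 0 < r) (hconv : ConvexOn ℝ (ball 0 r) u)
    (hcont : ContinuousOn u (ball 0 r))
    (hcomplete : IsIntrinsicallyComplete (graphMap u '' ball 0 r)) (M : ℝ) :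
    IsCompact {x | x ∈ ball (0 : Euc n) r ∧ u x ≤ M} := by
  refine (isCompact_closedBall (0 : Euc n) r).of_isClosed_subset ?_
    fun x hx => ball_subset_closedBall hx.1
  refine IsSeqClosed.isClosed fun x y hx hlim => ?_
  have hy : ‖y‖ ≤ r := by
    have : y ∈ closedBall (0 : Euc n) r := isClosed_closedBall.mem_of_tendsto hlim
      (Eventually.of_forall fun k => ball_subset_closedBall (hx k).1)
    simpa using this
  rcases hy.lt_or_eq with hlt | heq
  · have hyb : y ∈ ball (0 : Euc n) r := by simpa using hlt
    refine ⟨hyb, le_of_tendsto ((hcont.continuousAt (isOpen_ball.mem_nhds hyb)).tendsto.comp hlim)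
      (Eventually.of_forall fun k => (hx k).2)⟩
  -- If the limit `y` lies on the sphere, convexity on the segments from `0` to `x k` bounds `u`
  -- along the whole radius to `y`.
  · refine (not_bddAbove_radial hr hconv hcont hcomplete heq (M := max (u 0) M)
      fun s hs => ?_).elim
    have hsy := smul_mem_ball_of_mem_Ico hr heq.le hs
    refine le_of_tendsto ((hcont.continuousAt (isOpen_ball.mem_nhds hsy)).tendsto.comp
      (hlim.const_smul s)) (Eventually.of_forall fun k => ?_)
    have h0 : (0 : Euc n) ∈ ball (0 : Euc n) r := mem_ball_self hr
    refine (hconv.le_max_of_mem_segment h0 (hx k).1 ⟨1 - s, s, by linarith [hs.2], hs.1,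
      by ring, by simp⟩).trans (max_le_max le_rfl (hx k).2)

end Properness

/-! ### Second-order conditions along lines. -/

section SecondOrder

variable {E : Type*} [NormedAddCommGroup E] [NormedSpace ℝ E]

lemma hasDerivAt_along_line {f : E → ℝ} {x v : E} {s : ℝ}
    (hf : DifferentiableAt ℝ f (x + s • v)) :
    HasDerivAt (fun t : ℝ => f (x + t • v)) (fderiv ℝ f (x + s • v) v) s := by
  have h : HasDerivAt (fun t : ℝ => x + t • v) v s := by
    simpa using ((hasDerivAt_id s).smul_const v).const_add x
  exact hf.hasFDerivAt.comp_hasDerivAt s h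

lemma hasDerivAt_fderiv_along_line {f : E → ℝ} {x v : E} {s : ℝ}
    (hf : ContDiffAt ℝ 2 f (x + s • v)) :
    HasDerivAt (fun t : ℝ => fderiv ℝ f (x + t • v) v)
      (fderiv ℝ (fderiv ℝ f) (x + s • v) v v) s := by
  have h : HasDerivAt (fun t : ℝ => x + t • v) v s := by
    simpa using ((hasDerivAt_id s).smul_const v).const_add x
  have hd : DifferentiableAt ℝ (fderiv ℝ f) (x + s • v) :=
    (hf.fderiv_right (m := 1) (by norm_num)).differentiableAt (by norm_num)
  have h1 : HasDerivAt (fun t : ℝ => fderiv ℝ f (x + t • v))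
      (fderiv ℝ (fderiv ℝ f) (x + s • v) v) s := hd.hasFDerivAt.comp_hasDerivAt s h
  have h2 := h1.clm_apply (hasDerivAt_const s v)
  rwa [map_zero, add_zero] at h2

/-- A function with nonnegative Hessian on an open convex set is convex. -/
lemma convexOn_of_hessian_nonneg {s : Set E} (hs : IsOpen s) (hsc : Convex ℝ s) {f : E → ℝ}
    (hf : ContDiffOn ℝ 2 f s) (hpos : ∀ x ∈ s, ∀ v, 0 ≤ fderiv ℝ (fderiv ℝ f) x v v) :
    ConvexOn ℝ s f := by
  refine ⟨hsc, fun x hx y hy a b ha hb hab => ?_⟩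
  have hmem : ∀ t ∈ Icc (0 : ℝ) 1, x + t • (y - x) ∈ s := fun t ht =>
    hsc.add_smul_sub_mem hx hy ht
  have hfa : ∀ t ∈ Icc (0 : ℝ) 1, ContDiffAt ℝ 2 f (x + t • (y - x)) := fun t ht =>
    hf.contDiffAt (hs.mem_nhds (hmem t ht))
  have hconv : ConvexOn ℝ (Icc (0 : ℝ) 1) fun t => f (x + t • (y - x)) :=
    convexOn_of_hasDerivWithinAt2_nonneg (convex_Icc 0 1)
      (fun t ht => (hasDerivAt_along_line
        ((hfa t ht).differentiableAt (by norm_num))).continuousAt.continuousWithinAt)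
      (fun t ht => (hasDerivAt_along_line
        ((hfa t (interior_subset ht)).differentiableAt (by norm_num))).hasDerivWithinAt)
      (fun t ht => (hasDerivAt_fderiv_along_line (hfa t (interior_subset ht))).hasDerivWithinAt)
      (fun t ht => hpos _ (hmem t (interior_subset ht)) _)
  have h := hconv.2 (left_mem_Icc.mpr zero_le_one) (right_mem_Icc.mpr zero_le_one) ha hb hab
  have e : x + b • (y - x) = a • x + b • y := by
    rw [← eq_sub_iff_add_eq] at hab
    rw [hab]
    module
  simpa [e] using h

/-- If `f'' < 0`, the point would also be a local maximum, so `f` would be locally constant and `f''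
= 0`. -/
lemma second_deriv_nonneg_of_isLocalMin {f f' : ℝ → ℝ} {x f'' : ℝ} (hmin : IsLocalMin f x)
    (h1 : ∀ᶠ t in 𝓝 x, HasDerivAt f (f' t) t) (h2 : HasDerivAt f' f'' x) : 0 ≤ f'' := by
  by_contra! hneg
  have hd : deriv f =ᶠ[𝓝 x] f' := h1.mono fun t ht => ht.deriv
  have hdd : deriv (deriv f) x = f'' := by rw [hd.deriv_eq, h2.deriv]
  have hmax : IsLocalMax f x := isLocalMax_of_deriv_deriv_neg (by rwa [hdd]) hmin.deriv_eq_zero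
    h1.self_of_nhds.continuousAt
  have hconst : f =ᶠ[𝓝 x] fun _ => f x := by
    filter_upwards [hmin, hmax] with t ht1 ht2 using le_antisymm ht2 ht1
  have : deriv (deriv f) x = 0 := by
    rw [hconst.deriv.deriv_eq]
    simp
  linarith

/-- First and second order conditions at a local minimum of a difference of two functions, the
second one composed with a similarity of ratio `c⁻¹` and scaled by `c`. -/
lemma derivs_of_isLocalMin_sub_scaled {u : E → ℝ} {x w : E} (R : E ≃L[ℝ] E) {c : ℝ} (hc : 0 < c)
    (hx : ContDiffAt ℝ 2 u x) (hy : ContDiffAt ℝ 2 u (c⁻¹ • (R x + w)))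
    (hmin : IsLocalMin (fun z => u z - c * u (c⁻¹ • (R z + w))) x) (v : E) :
    fderiv ℝ u x v = fderiv ℝ u (c⁻¹ • (R x + w)) (R v) ∧
      c⁻¹ * fderiv ℝ (fderiv ℝ u) (c⁻¹ • (R x + w)) (R v) (R v) ≤
        fderiv ℝ (fderiv ℝ u) x v v := by
  set y := c⁻¹ • (R x + w) with hydef
  -- Each derivative of the scaled copy brings a factor `c⁻¹`. With the prefactor `c`, gradients are
  -- unscaled and Hessians keep one `c⁻¹`.
  have hline : ∀ t : ℝ, c⁻¹ • (R (x + t • v) + w) = y + t • (c⁻¹ • R v) := by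
    intro t
    rw [hydef, map_add, map_smul]
    module
  have hcx : ContinuousAt (fun t : ℝ => x + t • v) 0 := by fun_prop
  have hcy : ContinuousAt (fun t : ℝ => y + t • (c⁻¹ • R v)) 0 := by fun_prop
  have hmin' : IsLocalMin (fun t : ℝ => u (x + t • v) - c * u (y + t • (c⁻¹ • R v))) 0 := by
    have h := hcx.tendsto
    simp only [zero_smul, add_zero] at h
    have := h.eventually hmin
    refine this.mono fun t ht => ?_
    simpa only [hline, zero_smul, add_zero] using ht
  have hex : ∀ᶠ t in 𝓝 (0 : ℝ), ContDiffAt ℝ 2 u (x + t • v) :=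
    hcx.tendsto.eventually (by simpa using hx.eventually (by norm_num))
  have hey : ∀ᶠ t in 𝓝 (0 : ℝ), ContDiffAt ℝ 2 u (y + t • (c⁻¹ • R v)) :=
    hcy.tendsto.eventually (by simpa using hy.eventually (by norm_num))
  have h1 : ∀ᶠ t in 𝓝 (0 : ℝ),
      HasDerivAt (fun t : ℝ => u (x + t • v) - c * u (y + t • (c⁻¹ • R v)))
        (fderiv ℝ u (x + t • v) v -
          c * fderiv ℝ u (y + t • (c⁻¹ • R v)) (c⁻¹ • R v)) t := by
    filter_upwards [hex, hey] with t ht1 ht2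
    exact (hasDerivAt_along_line (ht1.differentiableAt (by norm_num))).sub
      ((hasDerivAt_along_line (ht2.differentiableAt (by norm_num))).const_mul c)
  have h2 := (hasDerivAt_fderiv_along_line hex.self_of_nhds).sub
    ((hasDerivAt_fderiv_along_line hey.self_of_nhds).const_mul c)
  constructor
  · have h := hmin'.hasDerivAt_eq_zero h1.self_of_nhds
    simp only [zero_smul, add_zero, map_smul, smul_eq_mul] at h
    rw [mul_inv_cancel_left₀ hc.ne'] at h
    linarith
  · have h := second_deriv_nonneg_of_isLocalMin hmin' h1 h2
    simp only [zero_smul, add_zero, map_smul, smul_eq_mul, smul_apply] at h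
    rw [mul_inv_cancel_left₀ hc.ne'] at h
    linarith

end SecondOrder

/-! ### Monotonicity of the speed and exclusion of touching by a shrunken copy. -/

section Speed

variable {n : ℕ} {Γ : Set (Fin n → ℝ)} {γ : (Fin n → ℝ) → ℝ} {α : ℝ}

/-- A speed function is monotone on the positive cone. -/
lemma IsSpeedFunction.le_of_le (hγ : IsSpeedFunction Γ γ α) {l m : Fin n → ℝ} (hl : ∀ i, 0 < l i)
    (hlm : ∀ i, l i ≤ m i) : γ l ≤ γ m := by
  have hmem : ∀ t ∈ Icc (0 : ℝ) 1, l + t • (m - l) ∈ Γ := fun t ht =>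
    hγ.pos_cone_subset fun i => by
      have : 0 ≤ t * (m i - l i) := mul_nonneg ht.1 (sub_nonneg.mpr (hlm i))
      simpa using add_pos_of_pos_of_nonneg (hl i) this
  have hd : ∀ t ∈ Icc (0 : ℝ) 1, HasDerivAt (fun t : ℝ => γ (l + t • (m - l)))
      (fderiv ℝ γ (l + t • (m - l)) (m - l)) t := fun t ht =>
    hasDerivAt_along_line ((hγ.smooth.contDiffAt (hγ.isOpen.mem_nhds (hmem t ht))).differentiableAt
      (by norm_num))
  have hnonneg : ∀ t ∈ Icc (0 : ℝ) 1, 0 ≤ fderiv ℝ γ (l + t • (m - l)) (m - l) := by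
    intro t ht
    -- Hides the base point, which also contains `m - l`, from the next rewrite.
    generalize hL : fderiv ℝ γ (l + t • (m - l)) = L
    rw [pi_eq_sum_univ' (m - l), map_sum]
    refine Finset.sum_nonneg fun i _ => ?_
    rw [map_smul]
    refine mul_nonneg (sub_nonneg.mpr (hlm i)) ?_
    have := (hγ.increasing _ (hmem t ht) i).le
    rw [hL] at this
    convert this using 2
  have hmono : MonotoneOn (fun t : ℝ => γ (l + t • (m - l))) (Icc 0 1) :=
    monotoneOn_of_deriv_nonneg (convex_Icc 0 1)
      (fun t ht => (hd t ht).continuousAt.continuousWithinAt)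
      (fun t ht => (hd t (interior_subset ht)).differentiableAt.differentiableWithinAt)
      (fun t ht => by
        rw [(hd t (interior_subset ht)).deriv]
        exact hnonneg t (interior_subset ht))
  simpa using hmono (left_mem_Icc.mpr zero_le_one) (right_mem_Icc.mpr zero_le_one) zero_le_one

/-- Homogeneity of positive degree supplies the strictness on which the touching argument rests. -/
lemma IsSpeedFunction.lt_of_smul_le (hγ : IsSpeedFunction Γ γ α) {l m : Fin n → ℝ}
    (hl : ∀ i, 0 < l i) {k : ℝ} (hk : 1 < k) (hlm : ∀ i, k * l i ≤ m i) : γ l < γ m := by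
  have hlΓ : l ∈ Γ := hγ.pos_cone_subset hl
  have hk0 : 0 < k := by linarith
  calc γ l < k ^ α * γ l :=
        lt_mul_of_one_lt_left (hγ.pos l hlΓ) (Real.one_lt_rpow hk hγ.degree_pos)
    _ = γ (k • l) := (hγ.homogeneous l hlΓ k hk0).symm
    _ ≤ γ m := hγ.le_of_le (fun i => mul_pos hk0 (hl i)) hlm

/-- A strictly convex graphical translator cannot be touched from below by an isometric copy of
itself that has been shrunk. -/
lemma IsGraphTranslator.not_isLocalMin_sub_scaled (hγ : IsSpeedFunction Γ γ α) {r : ℝ}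
    {u : Euc n → ℝ} (hu : ContDiffOn ℝ 2 u (ball 0 r))
    (htr : IsGraphTranslator Γ γ u (graphMap u '' ball 0 r))
    (hconvex : ∀ p ∈ graphMap u '' ball 0 r, ∀ i, 0 < graphCurvatures u p i)
    (R : Euc n ≃ₗᵢ[ℝ] Euc n) (w : Euc n) {c : ℝ} (hc0 : 0 < c) (hc1 : c < 1) {x : Euc n}
    (hx : x ∈ ball (0 : Euc n) r) (hy : c⁻¹ • (R x + w) ∈ ball (0 : Euc n) r) :
    ¬ IsLocalMin (fun z => u z - c * u (c⁻¹ • (R z + w))) x := by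
  intro hmin
  have hux := hu.contDiffAt (isOpen_ball.mem_nhds hx)
  have huy := hu.contDiffAt (isOpen_ball.mem_nhds hy)
  have hder := derivs_of_isLocalMin_sub_scaled R.toContinuousLinearEquiv hc0 hux huy hmin
  have h1 := fun v => (hder v).1
  have h2 := fun v => (hder v).2
  have hcurv := smul_principalCurvatures_le hux huy R (inv_nonneg.mpr hc0.le) h1 h2
  have hposy := hconvex _ (mem_image_of_mem _ hy)
  have hlt := hγ.lt_of_smul_le (l := graphCurvatures u (graphMap u (c⁻¹ • (R x + w))))
    (m := graphCurvatures u (graphMap u x)) hposy ((one_lt_inv₀ hc0).mpr hc1)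
    (fun i => by simpa [graphCurvatures] using hcurv i)
  rw [(htr _ (mem_image_of_mem _ hx)).2, (htr _ (mem_image_of_mem _ hy)).2, baseProj_graphMap,
    baseProj_graphMap, inner_graphNormal_eLast, inner_graphNormal_eLast] at hlt
  -- The gradients correspond under an isometry, so both sides of `hlt` are the same vertical
  -- component of the normal.
  have hnorm : ‖fderiv ℝ u x‖ = ‖fderiv ℝ u (c⁻¹ • (R x + w))‖ := by
    have : fderiv ℝ u x = (fderiv ℝ u (c⁻¹ • (R x + w))).comp
        (R.toContinuousLinearEquiv : Euc n →L[ℝ] Euc n) := by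
      ext v
      exact h1 v
    rw [this]
    exact ContinuousLinearMap.opNorm_comp_linearIsometryEquiv _ R
  rw [hnorm] at hlt
  exact lt_irrefl _ hlt

end Speed

/-! ### Reflection in vertical hyperplanes. -/

section Reflection

variable {n : ℕ} {Γ : Set (Fin n → ℝ)} {γ : (Fin n → ℝ) → ℝ} {α : ℝ}

/-- Sublevel sets control the region where a convex function is smaller than its reflection. -/
lemma lt_of_lt_reflected {r t M : ℝ} (ht : 0 < t) {u : Euc n → ℝ}
    (hconv : ConvexOn ℝ (ball 0 r) u) {e : Euc n} (he : ‖e‖ = 1)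
    (hM : ∀ x : Euc n, ‖x‖ ^ 2 ≤ r ^ 2 - t ^ 2 → u x ≤ M)
    {x : Euc n} (hx : x ∈ ball (0 : Euc n) r) (hxt : t ≤ inner ℝ x e)
    (hlt : u x < u (x - (2 * (inner ℝ x e - t)) • e)) : u x < M := by
  have hr : 0 < r := (norm_nonneg x).trans_lt (by simpa using hx)
  have hxr : ‖x‖ ^ 2 < r ^ 2 := by
    have : ‖x‖ < r := by simpa using hx
    exact pow_lt_pow_left₀ this (norm_nonneg _) two_ne_zero
  have hnorm : ∀ k : ℝ, ‖x - k • e‖ ^ 2 = ‖x‖ ^ 2 - 2 * k * inner ℝ x e + k ^ 2 := by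
    intro k
    rw [norm_sub_sq_real, real_inner_smul_right, norm_smul, he, mul_one, Real.norm_eq_abs, sq_abs]
    ring
  set s : ℝ := inner ℝ x e with hs
  have hst : t < s := by
    refine lt_of_le_of_ne hxt fun h => ?_
    simp [← h] at hlt
  -- If `s ≤ 2 * t`, the mirror image lies between `x - s • e` and `x`; convexity and `hlt` bound
  -- its value by that at `x - s • e`, a point with squared norm below `r ^ 2 - t ^ 2`. If `s > 2 *
  -- t`, the mirror image itself has squared norm below `r ^ 2 - t ^ 2`.
  rcases le_or_gt s (2 * t) with h | h
  · have hzM : u (x - s • e) ≤ M := hM _ (by rw [hnorm]; nlinarith)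
    have hz : x - s • e ∈ ball (0 : Euc n) r := by
      rw [mem_ball_zero_iff, ← sq_lt_sq₀ (norm_nonneg _) hr.le, hnorm]
      nlinarith
    have hs0 : 0 < s := ht.trans hst
    have hseg : x - (2 * (s - t)) • e ∈ segment ℝ (x - s • e) x := by
      refine ⟨2 * (s - t) / s, 1 - 2 * (s - t) / s, by positivity [sub_pos.mpr hst], ?_, by ring, ?_⟩
      · rw [sub_nonneg, div_le_one hs0]
        linarith
      · have : (2 * (s - t)) • e = (2 * (s - t) / s) • (s • e) := by
          rw [smul_smul, div_mul_cancel₀ _ hs0.ne']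
        rw [this]
        module
    have hle := hconv.le_max_of_mem_segment hz hx hseg
    rcases le_max_iff.mp hle with h' | h'
    · exact hlt.trans_le (h'.trans hzM)
    · exact absurd hlt h'.not_gt
  · refine hlt.trans_le (hM _ ?_)
    rw [hnorm]
    nlinarith

lemma norm_sub_reflected_sq {x e : Euc n} (he : ‖e‖ = 1) (t : ℝ) :
    ‖x - (2 * (inner ℝ x e - t)) • e‖ ^ 2 = ‖x‖ ^ 2 - 4 * t * (inner ℝ x e - t) := by
  rw [norm_sub_sq_real, real_inner_smul_right, norm_smul, he, mul_one, Real.norm_eq_abs, sq_abs]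
  ring

lemma reflection_add_smul_eq {e : Euc n} (he : ‖e‖ = 1) (t : ℝ) (x : Euc n) :
    (ℝ ∙ e)ᗮ.reflection x + (2 * t) • e = x - (2 * (inner ℝ x e - t)) • e := by
  rw [Submodule.reflection_orthogonal_apply, Submodule.reflection_singleton_apply, he,
    real_inner_comm]
  simp only [RCLike.ofReal_real_eq_id, id, one_pow, div_one]
  module

/-- Comparison of a strictly convex complete graphical translator over a ball with its reflection
in a hyperplane that does not contain the center. -/
lemma reflected_le (hγ : IsSpeedFunction Γ γ α) {r : ℝ} (hr : 0 < r) {u : Euc n → ℝ}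
    (hu : ContDiffOn ℝ 2 u (ball 0 r)) (hconv : ConvexOn ℝ (ball 0 r) u)
    (hcomplete : IsIntrinsicallyComplete (graphMap u '' ball 0 r))
    (htr : IsGraphTranslator Γ γ u (graphMap u '' ball 0 r))
    (hconvex : ∀ p ∈ graphMap u '' ball 0 r, ∀ i, 0 < graphCurvatures u p i)
    {e : Euc n} (he : ‖e‖ = 1) {t : ℝ} (ht : 0 < t) {x : Euc n} (hx : x ∈ ball (0 : Euc n) r)
    (hxt : t ≤ inner ℝ x e) : u (x - (2 * (inner ℝ x e - t)) • e) ≤ u x := by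
  by_contra! hlt
  have hcont : ContinuousOn u (ball 0 r) := hu.continuousOn
  set R : Euc n ≃ₗᵢ[ℝ] Euc n := (ℝ ∙ e)ᗮ.reflection with hR
  set ρ : Euc n → Euc n := fun z => R z + (2 * t) • e with hρ
  have hρeq : ∀ z, ρ z = z - (2 * (inner ℝ z e - t)) • e := reflection_add_smul_eq he t
  have hρcont : Continuous ρ := by fun_prop
  have hρball : ∀ z ∈ ball (0 : Euc n) r, t ≤ inner ℝ z e → ρ z ∈ ball (0 : Euc n) r := by
    intro z hz hzt
    rw [mem_ball_zero_iff] at hz ⊢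
    refine lt_of_le_of_lt ?_ hz
    rw [← sq_le_sq₀ (norm_nonneg _) (norm_nonneg _), hρeq, norm_sub_reflected_sq he]
    nlinarith
  obtain ⟨M, hM⟩ : ∃ M, ∀ z : Euc n, ‖z‖ ^ 2 ≤ r ^ 2 - t ^ 2 → u z ≤ M := by
    have hsub : closedBall (0 : Euc n) √(r ^ 2 - t ^ 2) ⊆ ball 0 r := by
      refine closedBall_subset_ball ?_
      rw [Real.sqrt_lt' hr]
      nlinarith
    obtain ⟨M, hM⟩ := ((isCompact_closedBall (0 : Euc n) √(r ^ 2 - t ^ 2)).image_of_continuousOn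
      (hcont.mono hsub)).bddAbove
    refine ⟨M, fun z hz => hM (mem_image_of_mem _ ?_)⟩
    rw [mem_closedBall_zero_iff]
    exact Real.le_sqrt_of_sq_le hz
  have hneg : ∀ z ∈ ball (0 : Euc n) r, t ≤ inner ℝ z e → u z < u (ρ z) → u z < M := by
    intro z hz hzt h
    rw [hρeq] at h
    exact lt_of_lt_reflected ht hconv he hM hz hzt h
  rw [← hρeq] at hlt
  -- The level `M + 1` leaves room: points with `u < u ∘ ρ` satisfy `u < M`, so they never lie on
  -- the top level of `D`.
  set D : Set (Euc n) := {z | z ∈ ball (0 : Euc n) r ∧ u z ≤ M + 1} ∩ {z | t ≤ inner ℝ z e} with hD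
  have hDc : IsCompact D := (isCompact_sublevel hr hconv hcont hcomplete (M + 1)).inter_right
    (isClosed_le continuous_const (by fun_prop))
  have hxD : x ∈ D := ⟨⟨hx, by linarith [hneg x hx hxt hlt]⟩, hxt⟩
  set m : ℝ := u (ρ x) - u x with hm
  have hm0 : 0 < m := sub_pos.mpr hlt
  have hclose : ∀ᶠ c in 𝓝 (1 : ℝ), ∀ z ∈ D,
      c⁻¹ • ρ z ∈ ball (0 : Euc n) r ∧ |c * u (c⁻¹ • ρ z) - u (ρ z)| < m / 4 := by
    refine hDc.eventually_forall_of_forall_eventually fun z hz => ?_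
    have hzb := hρball z hz.1.1 hz.2
    have hu1 : ContinuousAt u (ρ z) := hcont.continuousAt (isOpen_ball.mem_nhds hzb)
    have hi : ContinuousAt (fun q : ℝ × Euc n => q.1⁻¹ • ρ q.2) (1, z) :=
      (continuousAt_fst.inv₀ one_ne_zero).smul (hρcont.continuousAt.comp continuousAt_snd)
    have h1 : ContinuousAt (fun q : ℝ × Euc n => q.1 * u (q.1⁻¹ • ρ q.2)) (1, z) :=
      continuousAt_fst.mul (ContinuousAt.comp (g := u) (by simpa using hu1) hi)
    have h2 : ContinuousAt (fun q : ℝ × Euc n => u (ρ q.2)) (1, z) :=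
      ContinuousAt.comp (g := u) hu1 (hρcont.continuousAt.comp continuousAt_snd)
    have h3 : ContinuousAt (fun q : ℝ × Euc n => |q.1 * u (q.1⁻¹ • ρ q.2) - u (ρ q.2)|) (1, z) :=
      (h1.sub h2).abs
    exact (hi.eventually_mem (isOpen_ball.mem_nhds (by simpa using hzb))).and
      (h3.eventually_lt_const (by simpa using by positivity))
  obtain ⟨c, ⟨hcD, hc0⟩, hc1⟩ : ∃ c : ℝ, ((∀ z ∈ D, c⁻¹ • ρ z ∈ ball (0 : Euc n) r ∧
      |c * u (c⁻¹ • ρ z) - u (ρ z)| < m / 4) ∧ 0 < c) ∧ c < 1 :=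
    (((hclose.and (eventually_gt_nhds one_pos)).filter_mono nhdsWithin_le_nhds).and
      (self_mem_nhdsWithin (s := Iio (1 : ℝ)))).exists
  obtain ⟨y, hyD, hymin⟩ := hDc.exists_isMinOn ⟨x, hxD⟩
    (f := fun z => u z - c * u (c⁻¹ • ρ z))
    ((hcont.mono fun z hz => hz.1.1).sub (continuousOn_const.mul
      (hcont.comp (by fun_prop) fun z hz => (hcD z hz).1)))
  -- Scaling changes values on `D` by less than `m / 4`. The minimum is thus below `-3m/4`, and the
  -- unscaled difference at `y` is below `-m/2`.
  have hyneg : u y < u (ρ y) := by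
    have h1 : u y - c * u (c⁻¹ • ρ y) ≤ u x - c * u (c⁻¹ • ρ x) := hymin hxD
    have h2 := (abs_lt.mp (hcD x hxD).2).1
    have h3 := (abs_lt.mp (hcD y hyD).2).2
    linarith
  -- On the mirror itself `ρ y = y`, which `hyneg` rules out.
  have hyt : t < inner ℝ y e := by
    refine lt_of_le_of_ne hyD.2 fun h => ?_
    rw [hρeq, ← h] at hyneg
    simp at hyneg
  have hyM := hneg y hyD.1.1 hyD.2 hyneg
  have hDnhds : D ∈ 𝓝 y := by
    have hb : ball (0 : Euc n) r ∈ 𝓝 y := isOpen_ball.mem_nhds hyD.1.1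
    have h1 : ∀ᶠ z in 𝓝 y, u z < M + 1 :=
      (hcont.continuousAt hb).eventually_lt_const (by linarith)
    have h2 : ∀ᶠ z in 𝓝 y, t < inner ℝ z e :=
      (Continuous.continuousAt (by fun_prop)).eventually_const_lt hyt
    filter_upwards [hb, h1, h2] with z hz1 hz2 hz3 using ⟨⟨hz1, hz2.le⟩, hz3.le⟩
  exact htr.not_isLocalMin_sub_scaled hγ hu hconvex R ((2 * t) • e) hc0 hc1 hyD.1.1
    (hcD y hyD).1 (hymin.isLocalMin hDnhds)

/-- The perpendicular bisector of two points of equal norm passes through the origin; it is the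
limit as `t → 0⁺` of the mirrors `⟨·, e⟩ = t`. Exchanging the points reverses the inequality. -/
lemma eq_of_norm_eq (hγ : IsSpeedFunction Γ γ α) {r : ℝ} (hr : 0 < r) {u : Euc n → ℝ}
    (hu : ContDiffOn ℝ 2 u (ball 0 r))
    (hcomplete : IsIntrinsicallyComplete (graphMap u '' ball 0 r))
    (htr : IsGraphTranslator Γ γ u (graphMap u '' ball 0 r))
    (hconvex : ∀ p ∈ graphMap u '' ball 0 r, ∀ i, 0 < graphCurvatures u p i)
    {x y : Euc n} (hx : x ∈ ball (0 : Euc n) r) (hxy : ‖x‖ = ‖y‖) : u x = u y := by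
  have hconv : ConvexOn ℝ (ball 0 r) u := by
    refine convexOn_of_hessian_nonneg isOpen_ball (convex_ball 0 r) hu fun z hz v => ?_
    refine hessian_nonneg_of_principalCurvatures_pos (hu.contDiffAt (isOpen_ball.mem_nhds hz))
      (fun i => ?_) v
    simpa [graphCurvatures] using hconvex _ (mem_image_of_mem _ hz) i
  have key : ∀ x y : Euc n, x ∈ ball (0 : Euc n) r → ‖x‖ = ‖y‖ → u y ≤ u x := by
    intro x y hx hxy
    rcases eq_or_ne x y with rfl | hne
    · exact le_rfl
    have hd : 0 < ‖x - y‖ := norm_pos_iff.mpr (sub_ne_zero.mpr hne)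
    have hyb : y ∈ ball (0 : Euc n) r := by simpa [← hxy] using hx
    set e : Euc n := ‖x - y‖⁻¹ • (x - y) with he
    have hen : ‖e‖ = 1 := by
      rw [he, norm_smul, norm_inv, norm_norm, inv_mul_cancel₀ hd.ne']
    have hin : inner ℝ x e = ‖x - y‖ / 2 := by
      have h1 := norm_sub_sq_real x y
      have h2 : inner ℝ x (x - y) = ‖x - y‖ ^ 2 / 2 := by
        rw [inner_sub_right, real_inner_self_eq_norm_sq, h1, ← hxy]
        ring
      rw [he, real_inner_smul_right, h2]
      field_simp
    have hy : x - (2 * inner ℝ x e) • e = y := by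
      rw [hin, he, smul_smul, mul_div_cancel₀ _ two_ne_zero, mul_inv_cancel₀ hd.ne']
      module
    have hlim : Tendsto (fun t : ℝ => u (x - (2 * (inner ℝ x e - t)) • e)) (𝓝[>] 0) (𝓝 (u y)) := by
      have h1 : ContinuousAt (fun t : ℝ => x - (2 * (inner ℝ x e - t)) • e) 0 := by fun_prop
      have h2 : ContinuousAt u (x - (2 * (inner ℝ x e - 0)) • e) := by
        rw [sub_zero, hy]
        exact hu.continuousOn.continuousAt (isOpen_ball.mem_nhds hyb)
      have h3 : Tendsto (fun t : ℝ => u (x - (2 * (inner ℝ x e - t)) • e)) (𝓝 0)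
          (𝓝 (u (x - (2 * (inner ℝ x e - 0)) • e))) := h2.tendsto.comp h1.tendsto
      rw [sub_zero, hy] at h3
      exact h3.mono_left nhdsWithin_le_nhds
    refine le_of_tendsto hlim ?_
    filter_upwards [Ioo_mem_nhdsGT (by rw [hin]; positivity : (0 : ℝ) < inner ℝ x e)] with t ht
    exact reflected_le hγ hr hu hconv hcomplete htr hconvex hen ht.1 hx ht.2.le
  exact le_antisymm (key y x (by simpa [← hxy] using hx) hxy.symm) (key x y hx hxy)

end Reflection

/-! ### From radial functions to rotational symmetry. -/

/-- The graph of a radial function is rotationally symmetric. -/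
lemma isRotationallySymmetric_graph {n : ℕ} {r : ℝ} {u : Euc n → ℝ}
    (hu : ∀ x y : Euc n, x ∈ ball (0 : Euc n) r → ‖x‖ = ‖y‖ → u x = u y) :
    IsRotationallySymmetric (graphMap u '' ball 0 r) := by
  have hsub : ∀ A : Euc (n + 1) ≃ₗᵢ[ℝ] Euc (n + 1), A (eLast n) = eLast n →
      A '' (graphMap u '' ball 0 r) ⊆ graphMap u '' ball 0 r := by
    rintro A hA _ ⟨_, ⟨x, hx, rfl⟩, rfl⟩
    -- `A` fixes the axis, so it preserves the horizontal hyperplane and acts there isometrically.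
    have horth : inner ℝ (A (horizontalIncl n x)) (eLast n) = 0 := by
      rw [← hA, A.inner_map_map, inner_horizontalIncl_eLast]
    have hlast : A (horizontalIncl n x) (Fin.last n) = 0 := by
      rw [real_inner_comm] at horth
      simpa [eLast, EuclideanSpace.inner_single_left] using horth
    set y := baseProj (A (horizontalIncl n x)) with hy
    have hAy : A (horizontalIncl n x) = horizontalIncl n y := by
      ext i
      refine Fin.lastCases ?_ (fun j => ?_) i
      · simp [hlast]
      · simp [hy, baseProj]
    have hnorm : ∀ v : Euc n, ‖horizontalIncl n v‖ = ‖v‖ := fun v => by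
      rw [← sq_eq_sq₀ (norm_nonneg _) (norm_nonneg _), ← real_inner_self_eq_norm_sq,
        ← real_inner_self_eq_norm_sq, inner_horizontalIncl]
    have hxy : ‖x‖ = ‖y‖ := by rw [← hnorm x, ← A.norm_map, hAy, hnorm]
    refine ⟨y, by simpa [← hxy] using hx, ?_⟩
    rw [graphMap_eq, graphMap_eq, map_add, map_smul, hA, hAy, hu x y hx hxy]
  intro A hA
  refine (hsub A hA).antisymm fun p hp => ?_
  refine ⟨A.symm p, hsub A.symm ?_ (mem_image_of_mem _ hp), A.apply_symm_apply p⟩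
  rw [A.symm_apply_eq, hA]

theorem theorem1p4 (n : ℕ) (hn : 2 ≤ n) (Γ : Set (Fin n → ℝ)) (γ : (Fin n → ℝ) → ℝ) (α : ℝ)
    (hγ : IsSpeedFunction Γ γ α) (r : ℝ) (hr : 0 < r) (u : Euc n → ℝ)
    (hu : ContDiffOn ℝ ∞ u (Metric.ball 0 r)) (S : Set (Euc (n + 1)))
    (hgraph : S = graphMap u '' Metric.ball 0 r)
    (hcomplete : IsIntrinsicallyComplete S)
    (htranslator : IsGraphTranslator Γ γ u S)
    (hconvex : ∀ p ∈ S, ∀ i, 0 < graphCurvatures u p i)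
    (hend : HasSingleEnd S)
    (hasymptotic : IsAsymptoticToCylinder S (graphCurvatures u) r) :
    IsRotationallySymmetric S := by
  subst hgraph
  exact isRotationallySymmetric_graph fun x y hx hxy =>
    eq_of_norm_eq hγ hr (hu.of_le (mod_cast ENat.LEInfty.out)) hcomplete htranslator hconvex hx hxy
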